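/- A convex body in $\mathbb{R}^n$ is a compact convex set with nonempty interior. For a convex body $Q\subset\mathbb{R}^n$ with centroid $c(Q)=\frac{1}{\mathrm{vol}(Q)}\int_Q x\,dx$ and $\lambda\in\mathbb{R}$ put $\lambda\odot Q=\lambda(Q-c(Q))+c(Q)$. A finite sequence of convex bodies $Q_1,\dots,Q_N$ is a $(2,\epsilon)$-covering of a convex body $K\subset\mathbb{R}^n$ if $$K\subseteq\bigcup_{i=1}^N Q_i\subseteq\bigcup_{i=1}^N 2\odot Q_i\subseteq(1+\epsilon)K .$$ For $1\le p<\infty$ let $B_p^n=\{x\in\mathbb{R}^n : (\sum_{i=1}^n|x_i|^p)^{1/p}\le 1\}$. There is an absolute constant $\epsilon_0>0$ such that the following hold. (i) For every $2\le p<\infty$ there is a constant $c$, depending only on $p$, such that for all $n\ge 1$ and all $0<\epsilon\le\epsilon_0$ the ball $B_p^n$ has a $(2,\epsilon)$-covering by at most $$2^{cn}\,\log(1/\epsilon)\,(1/\epsilon)^{n/2}$$ convex bodies. (ii) There is an absolute constant $c$ such that for all $1\le p\le 2$, all $n\ge 1$ and all $0<\epsilon\le\epsilon_0$ the ball $B_p^n$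 has a $(2,\epsilon)$-covering by at most $$2^{cn}\,\log(1/\epsilon)\,(1/\epsilon)^{n/p}$$ convex bodies. -/

import Mathlib

open scoped Pointwise
open MeasureTheory

/-- A convex body in `ℝⁿ`: a compact convex set with nonempty interior. -/
def IsConvexBody {n : ℕ} (K : Set (Fin n → ℝ)) : Prop :=
  Convex ℝ K ∧ IsCompact K ∧ (interior K).Nonempty

/-- The centroid (center of mass) `c(Q) = vol(Q)⁻¹ ∫_Q x dx` with respect to Lebesgue measure. -/
noncomputable def bodyCentroid {n : ℕ} (Q : Set (Fin n → ℝ)) : Fin n → ℝ :=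
  ⨍ x in Q, x ∂(volume : Measure (Fin n → ℝ))

/-- The homothetic copy `r ⊙ Q = r (Q - c(Q)) + c(Q)` of `Q` about its centroid. -/
noncomputable def homotheticCopy {n : ℕ} (r : ℝ) (Q : Set (Fin n → ℝ)) : Set (Fin n → ℝ) :=
  (fun x => r • (x - bodyCentroid Q) + bodyCentroid Q) '' Q

/-- The sequence `Q₁, …, Q_N` of convex bodies is a `(2, ε)`-covering of `K`. -/
def IsTwoCovering {n N : ℕ} (ε : ℝ) (K : Set (Fin n → ℝ)) (Q : Fin N → Set (Fin n → ℝ)) : Prop :=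
  (∀ i, IsConvexBody (Q i)) ∧
    K ⊆ ⋃ i, Q i ∧
    (⋃ i, Q i) ⊆ ⋃ i, homotheticCopy 2 (Q i) ∧
    (⋃ i, homotheticCopy 2 (Q i)) ⊆ (1 + ε) • K

/-- The closed unit ball of the `ℓ_p` norm on `ℝⁿ`, for finite `p`. -/
def lpUnitBall (n : ℕ) (p : ℝ) : Set (Fin n → ℝ) :=
  {x | (∑ i, |x i| ^ p) ^ (1 / p) ≤ 1}

/-!
The covering exists because `ℓ_p` norms are smooth. Let `‖·‖` be a norm on an `n`-dimensional space
with `‖u + h‖ + ‖u - h‖ ≤ 2 + 2 C ‖h‖ ^ q` for unit vectors `u` and `‖h‖ ≤ 1`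
(`HasPowerSmoothness`). For `ℓ_p` this holds with `q = p`, `C = 1` if `1 ≤ p ≤ 2`, and with `q = 2`,
`C = C(p)` if `p ≥ 2` (`hasPowerSmoothness_piLp_of_le_two`, `hasPowerSmoothness_piLp_of_two_le`).

If `f` is a norming functional of the unit vector `u`, smoothness gives
`‖u + h‖ ≤ 1 + f h + 2 C ‖h‖ ^ q`. Choose `ρ` of order `ε ^ (1 / q)`. Then adding to `u` a vector `h`
with `‖h‖ ≤ ρ` and `|f h| ≲ ε` raises the norm by `O(ε)` only, and conversely `h = w - u` is such a
vector for every unit vector `w` within `ρ` of `u` (`HasPowerSmoothness.abs_apply_sub_le`). Hence the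
cone over the `ρ`-neighbourhood of `u` in the sphere is covered by the sets
`{t u + h : t ∈ I, ‖h‖ ≤ ρ, |f h| ≲ ε}`, where the intervals `I` cover `[0, 1]`, and such a set,
dilated by the factor `2` about its centre, stays in `(1 + ε) K` as long as the doubled interval stays
in `[-1 - O(ε), 1 + O(ε)]`. Intervals of length comparable with their distance to `1`, down to
`ε`, do this, and `O(log (1 / ε))` of them suffice. The sets are centrally symmetric, so that their
centre is their centroid.

A volume comparison bounds a `ρ`-net of the sphere by `(3 / ρ) ^ n` points
(`exists_net_unit_sphere`), and the product of the two numbers is the claimed bound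
(`HasPowerSmoothness.exists_isTwoCovering`).
-/

/-! ### Smoothness of `ℓ_p` norms -/

/-- A power type bound for the modulus of smoothness of the norm: moving from a unit vector `u` by
`h` and by `-h` raises the average of the norm by at most `C ‖h‖ ^ q`. -/
def HasPowerSmoothness (E : Type*) [NormedAddCommGroup E] (C q : ℝ) : Prop :=
  ∀ u h : E, ‖u‖ = 1 → ‖h‖ ≤ 1 → ‖u + h‖ + ‖u - h‖ ≤ 2 + 2 * (C * ‖h‖ ^ q)

/-- The tangent line inequality for the convex function `x ↦ x ^ p`. -/
theorem rpow_sub_rpow_le_mul {x y p : ℝ} (hx : 0 ≤ x) (hy : 0 ≤ y) (hp : 1 ≤ p) :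
    x ^ p - y ^ p ≤ p * x ^ (p - 1) * (x - y) := by
  rcases hx.eq_or_lt with rfl | hx
  · rcases hp.eq_or_lt with rfl | hp
    · simp
    · rw [Real.zero_rpow (by linarith), Real.zero_rpow (by linarith)]
      have := Real.rpow_nonneg hy p
      linarith
  · have h := one_add_mul_self_le_rpow_one_add (s := y / x - 1)
      (by have := div_nonneg hy hx.le; linarith) hp
    rw [add_sub_cancel, Real.div_rpow hy hx.le, le_div_iff₀ (Real.rpow_pos_of_pos hx p)] at h
    have hxp : x ^ p = x ^ (p - 1) * x := by
      rw [← Real.rpow_add_one hx.ne', sub_add_cancel]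
    have e : (1 + p * (y / x - 1)) * x ^ p = x ^ p - p * x ^ (p - 1) * (x - y) := by
      rw [hxp]; field_simp; ring
    linarith

/-- Concavity of `x ↦ x ^ (p / 2)` reduces this to the parallelogram law, and its subadditivity
splits `a ^ 2 + b ^ 2`. -/
theorem abs_add_rpow_add_abs_sub_rpow_le_of_le_two {p : ℝ} (hp : 1 ≤ p) (hp2 : p ≤ 2) (a b : ℝ) :
    |a + b| ^ p + |a - b| ^ p ≤ 2 * |a| ^ p + 2 * |b| ^ p := by
  have key (x : ℝ) : |x| ^ p = (x ^ 2) ^ (p / 2) := by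
    rw [← sq_abs, ← Real.rpow_natCast, ← Real.rpow_mul (abs_nonneg x)]
    congr 1; push_cast; ring
  simp only [key]
  have hc := (Real.concaveOn_rpow (p := p / 2) (by linarith) (by linarith)).2
    (sq_nonneg (a + b)) (sq_nonneg (a - b)) (show (0 : ℝ) ≤ 1 / 2 by norm_num)
    (show (0 : ℝ) ≤ 1 / 2 by norm_num) (by norm_num)
  have hs := Real.rpow_add_le_add_rpow (sq_nonneg a) (sq_nonneg b) (p := p / 2)
    (by linarith) (by linarith)
  have e : (1 / 2 : ℝ) • (a + b) ^ 2 + (1 / 2 : ℝ) • (a - b) ^ 2 = a ^ 2 + b ^ 2 := by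
    simp only [smul_eq_mul]; ring
  rw [e] at hc
  simp only [smul_eq_mul] at hc
  linarith

/-- A second difference bound for `x ↦ x ^ p`. For `b ≤ a` it comes from the tangent line inequality,
applied to `x ^ p` and then to its derivative; for `a ≤ b` every term is at most of order `b ^ p`. -/
theorem add_rpow_add_abs_sub_rpow_le {p : ℝ} (hp : 2 ≤ p) {a b : ℝ} (ha : 0 ≤ a) (hb : 0 ≤ b) :
    (a + b) ^ p + |a - b| ^ p ≤ 2 * a ^ p + (2 * p ^ 2 + 8) * (b ^ 2 * (a + b) ^ (p - 2)) := by
  rcases hb.eq_or_lt with rfl | hb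
  · simp [abs_of_nonneg ha]; linarith
  have hab : 0 < a + b := by linarith
  have hw := Real.rpow_nonneg hab.le (p - 2)
  rcases le_total b a with h | h
  · rw [abs_of_nonneg (by linarith)]
    have h1 := rpow_sub_rpow_le_mul (x := a + b) (y := a) (p := p) hab.le ha (by linarith)
    have h2 := rpow_sub_rpow_le_mul (x := a - b) (y := a) (p := p) (by linarith) ha (by linarith)
    have h3 := rpow_sub_rpow_le_mul (x := a + b) (y := a - b) (p := p - 1) hab.le (by linarith)
      (by linarith)
    rw [show p - 1 - 1 = p - 2 by ring] at h3
    -- the sum of the first two inequalities is controlled by the third one times `p * b`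
    have h4 := mul_le_mul_of_nonneg_left h3 (show 0 ≤ p * b by positivity)
    have h5 : 0 ≤ (2 * p + 8) * (b ^ 2 * (a + b) ^ (p - 2)) := by positivity
    nlinarith
  · have h1 : |a - b| ^ p ≤ (a + b) ^ p :=
      Real.rpow_le_rpow (abs_nonneg _) (abs_le.2 ⟨by linarith, by linarith⟩) (by linarith)
    have h2 : (a + b) ^ p = (a + b) ^ (p - 2) * (a + b) ^ 2 := by
      rw [← Real.rpow_natCast, ← Real.rpow_add hab]; congr 1; push_cast; ring
    have h3 : (a + b) ^ 2 ≤ 4 * b ^ 2 := by nlinarith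
    have h4 := mul_le_mul_of_nonneg_left h3 hw
    have h5 : 0 ≤ 2 * p ^ 2 * (b ^ 2 * (a + b) ^ (p - 2)) := by positivity
    have h6 := Real.rpow_nonneg ha p
    nlinarith

/-- The weight `(|a| + |b|) ^ p` in the error term is cruder than `|a| ^ (p - 2) * b ^ 2`, but it sums
to a constant over the coordinates of two unit vectors of `ℓ_p`, without Hölder's inequality. -/
theorem abs_add_rpow_add_abs_sub_rpow_le_of_two_le {p : ℝ} (hp : 2 ≤ p) (a b : ℝ) {t : ℝ}
    (ht : 0 ≤ t) (ht1 : t ≤ 1) :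
    |a + t * b| ^ p + |a - t * b| ^ p ≤
      2 * |a| ^ p + (2 * p ^ 2 + 8) * t ^ 2 * (|a| + |b|) ^ p := by
  have hb : 0 ≤ t * |b| := by positivity
  have hswap : |a + t * b| ^ p + |a - t * b| ^ p =
      (|a| + t * |b|) ^ p + |(|a| - t * |b|)| ^ p := by
    rcases abs_cases a with ⟨h1, h1'⟩ | ⟨h1, h1'⟩ <;> rcases abs_cases b with ⟨h2, h2'⟩ | ⟨h2, h2'⟩ <;>
      rw [h1, h2] <;> rw [h2] at hb
    · rw [abs_of_nonneg (show 0 ≤ a + t * b by linarith)]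
    · rw [abs_of_nonneg (show 0 ≤ a - t * b by linarith), add_comm]
      congr 2 <;> ring_nf
    · rw [abs_sub_comm a, abs_of_nonneg (show 0 ≤ t * b - a by linarith), add_comm,
        ← abs_neg (a + t * b)]
      congr 2 <;> ring_nf
    · rw [abs_of_nonpos (show a + t * b ≤ 0 by linarith), ← abs_neg (a - t * b)]
      congr 2 <;> ring_nf
  rw [hswap]
  refine (add_rpow_add_abs_sub_rpow_le hp (abs_nonneg a) hb).trans ?_
  have h1 : (|a| + t * |b|) ^ (p - 2) ≤ (|a| + |b|) ^ (p - 2) :=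
    Real.rpow_le_rpow (by positivity)
      (by have := mul_le_of_le_one_left (abs_nonneg b) ht1; linarith) (by linarith)
  have h2 : |b| ^ 2 * (|a| + |b|) ^ (p - 2) ≤ (|a| + |b|) ^ p := by
    rcases (add_nonneg (abs_nonneg a) (abs_nonneg b)).eq_or_lt with h0 | h0
    · have : |b| = 0 := by linarith [abs_nonneg a, abs_nonneg b]
      rw [this]; simp; positivity
    · have : (|a| + |b|) ^ p = (|a| + |b|) ^ 2 * (|a| + |b|) ^ (p - 2) := by
        rw [← Real.rpow_natCast, ← Real.rpow_add h0]; congr 1; push_cast; ring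
      rw [this]
      gcongr
      linarith [abs_nonneg a]
  have h3 : (t * |b|) ^ 2 * (|a| + t * |b|) ^ (p - 2) ≤ t ^ 2 * (|a| + |b|) ^ p :=
    calc (t * |b|) ^ 2 * (|a| + t * |b|) ^ (p - 2)
        ≤ (t * |b|) ^ 2 * (|a| + |b|) ^ (p - 2) := by gcongr
      _ = t ^ 2 * (|b| ^ 2 * (|a| + |b|) ^ (p - 2)) := by ring
      _ ≤ _ := by gcongr
  rw [mul_assoc]
  gcongr

/-- By Bernoulli's inequality a bound on `p`-th powers near `1` passes to the numbers themselves. -/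
theorem add_le_of_rpow_add_rpow_le {p A B w : ℝ} (hp : 1 ≤ p) (hA : 0 ≤ A) (hB : 0 ≤ B)
    (hw : 0 ≤ w) (h : A ^ p + B ^ p ≤ 2 + 2 * w) : A + B ≤ 2 + 2 * w := by
  have h1 := one_add_mul_self_le_rpow_one_add (s := A - 1) (by linarith) hp
  have h2 := one_add_mul_self_le_rpow_one_add (s := B - 1) (by linarith) hp
  rw [add_sub_cancel] at h1 h2
  by_contra! hc
  nlinarith

theorem PiLp.norm_rpow_eq_sum {n : ℕ} {p : ℝ} (hp : 1 ≤ p)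
    (x : PiLp (ENNReal.ofReal p) (fun _ : Fin n => ℝ)) : ‖x‖ ^ p = ∑ i, |x i| ^ p := by
  have hp' : (ENNReal.ofReal p).toReal = p := ENNReal.toReal_ofReal (by linarith)
  rw [PiLp.norm_eq_sum (by rw [hp']; linarith), hp', ← Real.rpow_mul
    (Finset.sum_nonneg fun i _ => by positivity), one_div_mul_cancel (by linarith), Real.rpow_one]
  rfl

theorem hasPowerSmoothness_piLp_of_le_two {n : ℕ} {p : ℝ} (hp : 1 ≤ p) (hp2 : p ≤ 2)
    [Fact (1 ≤ ENNReal.ofReal p)] :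
    HasPowerSmoothness (PiLp (ENNReal.ofReal p) (fun _ : Fin n => ℝ)) 1 p := by
  intro u h hu _
  refine add_le_of_rpow_add_rpow_le hp (norm_nonneg _) (norm_nonneg _) (by positivity) ?_
  have hu' : ‖u‖ ^ p = 1 := by rw [hu, Real.one_rpow]
  rw [PiLp.norm_rpow_eq_sum hp] at hu'
  rw [one_mul, PiLp.norm_rpow_eq_sum hp, PiLp.norm_rpow_eq_sum hp, PiLp.norm_rpow_eq_sum hp,
    ← Finset.sum_add_distrib]
  refine (Finset.sum_le_sum fun i _ =>
    abs_add_rpow_add_abs_sub_rpow_le_of_le_two hp hp2 (u i) (h i)).trans_eq ?_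
  rw [Finset.sum_add_distrib, ← Finset.mul_sum, ← Finset.mul_sum, hu', mul_one]

theorem add_rpow_le_two_rpow_mul {p x y : ℝ} (hp : 0 ≤ p) (hx : 0 ≤ x) (hy : 0 ≤ y) :
    (x + y) ^ p ≤ 2 ^ p * (x ^ p + y ^ p) := by
  wlog h : x ≤ y generalizing x y
  · rw [add_comm x, add_comm (x ^ p)]
    exact this hy hx (le_of_not_ge h)
  calc (x + y) ^ p ≤ (2 * y) ^ p := Real.rpow_le_rpow (by positivity) (by linarith) hp
    _ = 2 ^ p * y ^ p := Real.mul_rpow (by norm_num) hy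
    _ ≤ _ := by gcongr; linarith [Real.rpow_nonneg hx p]

theorem hasPowerSmoothness_piLp_of_two_le {n : ℕ} {p : ℝ} (hp : 2 ≤ p)
    [Fact (1 ≤ ENNReal.ofReal p)] :
    HasPowerSmoothness (PiLp (ENNReal.ofReal p) (fun _ : Fin n => ℝ))
      ((2 * p ^ 2 + 8) * 2 ^ p) 2 := by
  intro u h hu hh
  have hp1 : 1 ≤ p := by linarith
  rcases eq_or_ne h 0 with rfl | hne
  · simp [hu]; norm_num
  have hpos : 0 < ‖h‖ := norm_pos_iff.2 hne
  obtain ⟨v, hv, hvh⟩ : ∃ v : PiLp (ENNReal.ofReal p) (fun _ : Fin n => ℝ),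
      ‖v‖ = 1 ∧ h = ‖h‖ • v :=
    ⟨‖h‖⁻¹ • h, by rw [norm_smul, norm_inv, norm_norm, inv_mul_cancel₀ hpos.ne'],
      by rw [smul_inv_smul₀ hpos.ne']⟩
  have hcoord (i : Fin n) : h i = ‖h‖ * v i := by
    conv_lhs => rw [hvh]
    rfl
  refine add_le_of_rpow_add_rpow_le hp1 (norm_nonneg _) (norm_nonneg _) (by positivity) ?_
  have hu' : ‖u‖ ^ p = 1 := by rw [hu, Real.one_rpow]
  have hv' : ‖v‖ ^ p = 1 := by rw [hv, Real.one_rpow]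
  rw [PiLp.norm_rpow_eq_sum hp1] at hu' hv'
  rw [PiLp.norm_rpow_eq_sum hp1, PiLp.norm_rpow_eq_sum hp1, ← Finset.sum_add_distrib]
  have hsum : ∑ i, (|u i| + |v i|) ^ p ≤ 2 ^ p * 2 := by
    refine (Finset.sum_le_sum fun i _ =>
      add_rpow_le_two_rpow_mul (by linarith) (abs_nonneg (u i)) (abs_nonneg (v i))).trans_eq ?_
    rw [← Finset.mul_sum, Finset.sum_add_distrib, hu', hv']
    norm_num
  calc ∑ i, (|(u + h) i| ^ p + |(u - h) i| ^ p)
      ≤ ∑ i, (2 * |u i| ^ p + (2 * p ^ 2 + 8) * ‖h‖ ^ 2 * (|u i| + |v i|) ^ p) :=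
        Finset.sum_le_sum fun i _ => by
          have := abs_add_rpow_add_abs_sub_rpow_le_of_two_le hp (u i) (v i) hpos.le hh
          rwa [← hcoord] at this
    _ = 2 + (2 * p ^ 2 + 8) * ‖h‖ ^ 2 * ∑ i, (|u i| + |v i|) ^ p := by
        rw [Finset.sum_add_distrib, ← Finset.mul_sum, ← Finset.mul_sum, hu', mul_one]
    _ ≤ 2 + (2 * p ^ 2 + 8) * ‖h‖ ^ 2 * (2 ^ p * 2) := by gcongr
    _ = _ := by rw [Real.rpow_two]; ring

/-! ### Coverings by centrally symmetric bodies -/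

/-- A point reflection that preserves a convex body fixes its centroid. -/
theorem bodyCentroid_eq_of_symmetric {n : ℕ} {Q : Set (Fin n → ℝ)} (hQ : IsConvexBody Q)
    {c : Fin n → ℝ} (hsymm : ∀ y ∈ Q, c + c - y ∈ Q) : bodyCentroid Q = c := by
  obtain ⟨-, hcomp, hint⟩ := hQ
  have hvol : volume.real Q ≠ 0 := by
    refine (ENNReal.toReal_pos ?_ hcomp.measure_lt_top.ne).ne'
    exact (Measure.measure_pos_of_nonempty_interior _ hint).ne'
  have hpre : (fun y => c + c - y) ⁻¹' Q = Q := by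
    ext y
    refine ⟨fun hy => ?_, hsymm y⟩
    simpa using hsymm _ hy
  have hid : IntegrableOn (fun y : Fin n → ℝ => y) Q volume :=
    continuous_id.continuousOn.integrableOn_compact hcomp
  have hconst : IntegrableOn (fun _ : Fin n → ℝ => c + c) Q volume :=
    continuous_const.continuousOn.integrableOn_compact hcomp
  have hreflect : ∫ y in Q, (c + c - y) = ∫ y in Q, y := by
    have := (Measure.measurePreserving_sub_left (volume : Measure (Fin n → ℝ))
      (c + c)).setIntegral_preimage_emb (Homeomorph.subLeft (c + c)).measurableEmbedding (fun y => y) Q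
    rwa [hpre] at this
  rw [integral_sub hconst hid, setIntegral_const] at hreflect
  have h2 : (2 : ℝ) • ∫ y in Q, y = (2 : ℝ) • (volume.real Q • c) := by
    rw [two_smul, two_smul, ← smul_add]
    nth_rewrite 1 [← hreflect]
    abel
  have h3 := smul_right_injective _ (two_ne_zero (α := ℝ)) h2
  rw [bodyCentroid, setAverage_eq, h3, inv_smul_smul₀ hvol]

section SmoothNorm

variable {E : Type*} [NormedAddCommGroup E] [NormedSpace ℝ E] {n : ℕ}

theorem isConvexBody_image_translate (e : E ≃L[ℝ] (Fin n → ℝ)) (x : E) {L : Set E}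
    (hconv : Convex ℝ L) (hcomp : IsCompact L) (hnhds : L ∈ nhds 0) :
    IsConvexBody (e '' ((fun l => x + l) '' L)) := by
  refine ⟨(hconv.translate x).is_linear_image e.toLinearEquiv.toLinearMap.isLinear,
    (hcomp.image (by fun_prop)).image e.continuous, ?_⟩
  refine ⟨e x, mem_interior_iff_mem_nhds.2 ?_⟩
  refine (e.toHomeomorph.isOpenMap.image_mem_nhds (x := x) ?_)
  have := (Homeomorph.addLeft x).isOpenMap.image_mem_nhds hnhds
  simpa using this

theorem homotheticCopy_image_translate (e : E ≃L[ℝ] (Fin n → ℝ)) (x : E) {L : Set E}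
    (hconv : Convex ℝ L) (hcomp : IsCompact L) (hnhds : L ∈ nhds 0) (hsymm : ∀ l ∈ L, -l ∈ L)
    (r : ℝ) :
    homotheticCopy r (e '' ((fun l => x + l) '' L)) = e '' ((fun l => x + r • l) '' L) := by
  have hc : bodyCentroid (e '' ((fun l => x + l) '' L)) = e x := by
    refine bodyCentroid_eq_of_symmetric (isConvexBody_image_translate e x hconv hcomp hnhds) ?_
    rintro _ ⟨_, ⟨l, hl, rfl⟩, rfl⟩
    refine ⟨_, ⟨-l, hsymm l hl, rfl⟩, ?_⟩
    simp only [map_add, map_neg]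
    abel
  rw [homotheticCopy, hc, Set.image_image, Set.image_image, Set.image_image]
  refine Set.image_congr fun l _ => ?_
  simp only [map_add, map_smul]
  rw [add_sub_cancel_left, add_comm]

/-- A family of centrally symmetric bodies `x i + L i` that covers the unit ball and stays in the
ball of radius `1 + ε` when each `L i` is doubled is a `(2, ε)`-covering: central symmetry places
the centroid at `x i`. -/
theorem exists_isTwoCovering_of_symmetric {ι : Type*} [Fintype ι] (e : E ≃L[ℝ] (Fin n → ℝ))
    {ε : ℝ} (hε : 0 < ε) (x : ι → E) (L : ι → Set E)
    (hconv : ∀ i, Convex ℝ (L i)) (hcomp : ∀ i, IsCompact (L i)) (hnhds : ∀ i, L i ∈ nhds 0)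
    (hsymm : ∀ i, ∀ l ∈ L i, -l ∈ L i)
    (hcover : ∀ y : E, ‖y‖ ≤ 1 → ∃ i, ∃ l ∈ L i, y = x i + l)
    (hdouble : ∀ i, ∀ l ∈ L i, ‖x i + (2 : ℝ) • l‖ ≤ 1 + ε) :
    ∃ Q : Fin (Fintype.card ι) → Set (Fin n → ℝ),
      IsTwoCovering ε (e '' Metric.closedBall 0 1) Q := by
  let φ := (Fintype.equivFin ι).symm
  have hcopy := fun i => homotheticCopy_image_translate e (x i) (hconv i) (hcomp i) (hnhds i)
    (hsymm i) 2
  refine ⟨fun j => e '' ((fun l => x (φ j) + l) '' L (φ j)),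
    fun j => isConvexBody_image_translate e _ (hconv _) (hcomp _) (hnhds _), ?_, ?_, ?_⟩
  · rintro _ ⟨y, hy, rfl⟩
    obtain ⟨i, l, hl, rfl⟩ := hcover y (by simpa using hy)
    exact Set.mem_iUnion.2 ⟨φ.symm i, _, ⟨l, by simpa using hl, rfl⟩, by simp⟩
  · refine Set.iUnion_mono fun j => ?_
    rw [hcopy]
    rintro _ ⟨_, ⟨l, hl, rfl⟩, rfl⟩
    refine ⟨_, ⟨(1 / 2 : ℝ) • l, ?_, rfl⟩, by simp [smul_smul]⟩
    exact (hconv (φ j)).smul_mem_of_zero_mem (mem_of_mem_nhds (hnhds _)) hl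
      ⟨by norm_num, by norm_num⟩
  · refine Set.iUnion_subset fun j => ?_
    rw [hcopy]
    rintro _ ⟨_, ⟨l, hl, rfl⟩, rfl⟩
    have h0 : (0 : ℝ) < 1 + ε := by linarith
    refine ⟨e ((1 + ε)⁻¹ • (x (φ j) + (2 : ℝ) • l)), ⟨_, ?_, rfl⟩, ?_⟩
    · rw [mem_closedBall_zero_iff, norm_smul, norm_inv, Real.norm_of_nonneg h0.le]
      exact inv_mul_le_one_of_le₀ (hdouble _ l hl) h0.le
    · simp only [map_smul]
      exact smul_inv_smul₀ h0.ne' _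

/-! ### Separated nets of the unit sphere -/

/-- The balls of radius `ρ / 2` around the points are disjoint and lie in the ball of radius `3 / 2`. -/
theorem card_le_of_separated_unit_sphere [FiniteDimensional ℝ E] {ρ : ℝ} (hρ : 0 < ρ)
    (hρ1 : ρ ≤ 1) (s : Finset E) (hs : ∀ c ∈ s, ‖c‖ = 1)
    (h : ∀ c ∈ s, ∀ d ∈ s, c ≠ d → ρ ≤ ‖c - d‖) :
    (s.card : ℝ) ≤ (3 / ρ) ^ Module.finrank ℝ E := by
  borelize E
  let μ : Measure E := Measure.addHaar
  have hD : Set.Pairwise (s : Set E) (Function.onFun Disjoint fun c => Metric.ball (c : E) (ρ / 2)) := by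
    intro c hc d hd hcd
    apply Metric.ball_disjoint_ball
    rw [dist_eq_norm]
    have := h c hc d hd hcd
    linarith
  have hsub : (⋃ c ∈ s, Metric.ball (c : E) (ρ / 2)) ⊆ Metric.ball (0 : E) (3 / 2) := by
    refine Set.iUnion₂_subset fun c hc => Metric.ball_subset_ball' ?_
    rw [dist_zero_right, hs c hc]
    linarith
  have hmeas : (s.card : ENNReal) * ENNReal.ofReal ((ρ / 2) ^ Module.finrank ℝ E) *
      μ (Metric.ball 0 1) ≤ ENNReal.ofReal ((3 / 2) ^ Module.finrank ℝ E) * μ (Metric.ball 0 1) := by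
    have := measure_mono (μ := μ) hsub
    rw [measure_biUnion_finset hD fun c _ => measurableSet_ball,
      μ.addHaar_ball_of_pos _ (by norm_num : (0 : ℝ) < 3 / 2)] at this
    simpa only [μ.addHaar_ball_of_pos _ (half_pos hρ), Finset.sum_const, nsmul_eq_mul, mul_assoc]
      using this
  have hcard := (ENNReal.mul_le_mul_iff_left (Metric.measure_ball_pos _ _ zero_lt_one).ne'
    measure_ball_lt_top.ne).1 hmeas
  have hreal := ENNReal.toReal_le_of_le_ofReal (by positivity) hcard
  rw [ENNReal.toReal_mul, ENNReal.toReal_natCast, ENNReal.toReal_ofReal (by positivity),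
    ← le_div_iff₀ (by positivity), ← div_pow] at hreal
  refine hreal.trans_eq ?_
  congr 1
  field_simp

theorem exists_net_unit_sphere [FiniteDimensional ℝ E] {ρ : ℝ} (hρ : 0 < ρ) (hρ1 : ρ ≤ 1) :
    ∃ s : Finset E, (∀ c ∈ s, ‖c‖ = 1) ∧ (s.card : ℝ) ≤ (3 / ρ) ^ Module.finrank ℝ E ∧
      ∀ w : E, ‖w‖ = 1 → ∃ c ∈ s, ‖w - c‖ ≤ ρ := by
  classical
  let P : ℕ → Prop := fun k => ∃ s : Finset E, (∀ c ∈ s, ‖c‖ = 1) ∧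
    (∀ c ∈ s, ∀ d ∈ s, c ≠ d → ρ ≤ ‖c - d‖) ∧ s.card = k
  have hbound : ∀ k, P k → k ≤ ⌊(3 / ρ) ^ Module.finrank ℝ E⌋₊ := by
    rintro _ ⟨s, hs, hsep, rfl⟩
    exact Nat.le_floor (card_le_of_separated_unit_sphere hρ hρ1 s hs hsep)
  obtain ⟨s, hs, hsep, hcard⟩ : P (Nat.findGreatest P ⌊(3 / ρ) ^ Module.finrank ℝ E⌋₊) :=
    Nat.findGreatest_spec (Nat.zero_le _) ⟨∅, by simp, by simp, rfl⟩
  refine ⟨s, hs, card_le_of_separated_unit_sphere hρ hρ1 s hs hsep, fun w hw => ?_⟩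
  -- a point farther than `ρ` from the whole set could be added to it, against maximality
  by_contra! hfar
  have hw_notin : w ∉ s := fun hws => by
    have := hfar w hws
    rw [sub_self, norm_zero] at this
    linarith
  have hP : P (s.card + 1) := by
    refine ⟨insert w s, ?_, ?_, Finset.card_insert_of_notMem hw_notin⟩
    · simpa [hw] using hs
    · intro c hc d hd hcd
      rcases Finset.mem_insert.1 hc with h1 | h1 <;> rcases Finset.mem_insert.1 hd with h2 | h2
      · exact absurd (h1.trans h2.symm) hcd
      · rw [h1]; exact (hfar d h2).le
      · rw [h2, norm_sub_rev]; exact (hfar c h1).le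
      · exact hsep c h1 d h2 hcd
  have := Nat.le_findGreatest (hbound _ hP) hP
  omega

/-! ### Covering the unit ball of a smooth norm -/

/-- The symmetric body whose translates are the pieces of the covering: a segment of half-length `r`
in the radial direction `u`, thickened by the vectors of norm at most `ρ` that are tangential up to
`η`, as measured by the functional `f`. -/
def radialSlab (u : E) (f : StrongDual ℝ E) (r ρ η : ℝ) : Set E :=
  (fun s : ℝ => s • u) '' Set.Icc (-r) r + {h | ‖h‖ ≤ ρ ∧ |f h| ≤ η}

theorem convex_radialSlab (u : E) (f : StrongDual ℝ E) (r ρ η : ℝ) :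
    Convex ℝ (radialSlab u f r ρ η) := by
  refine ((convex_Icc _ _).is_linear_image (LinearMap.toSpanSingleton ℝ E u).isLinear).add ?_
  have h1 : Convex ℝ (Metric.closedBall (0 : E) ρ) := convex_closedBall _ _
  have h2 : Convex ℝ (f ⁻¹' Metric.closedBall 0 η) :=
    (convex_closedBall (0 : ℝ) η).is_linear_preimage f.toLinearMap.isLinear
  convert! h1.inter h2 using 1
  ext h
  simp

theorem isCompact_radialSlab [FiniteDimensional ℝ E] (u : E) (f : StrongDual ℝ E) (r ρ η : ℝ) :
    IsCompact (radialSlab u f r ρ η) := by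
  have : ProperSpace E := FiniteDimensional.proper ℝ E
  refine (isCompact_Icc.image (by fun_prop)).add ?_
  have h2 : IsClosed (f ⁻¹' Metric.closedBall 0 η) := Metric.isClosed_closedBall.preimage f.continuous
  convert! (isCompact_closedBall (0 : E) ρ).inter_right h2 using 1
  ext h
  simp

theorem radialSlab_mem_nhds (u : E) (f : StrongDual ℝ E) {r ρ η : ℝ} (hr : 0 ≤ r) (hρ : 0 < ρ)
    (hη : 0 < η) : radialSlab u f r ρ η ∈ nhds 0 := by
  have h1 : Metric.closedBall (0 : E) ρ ∈ nhds 0 := Metric.closedBall_mem_nhds _ hρ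
  have h2 : f ⁻¹' Metric.closedBall 0 η ∈ nhds 0 :=
    f.continuous.continuousAt.preimage_mem_nhds (by
      rw [map_zero]; exact Metric.closedBall_mem_nhds _ hη)
  filter_upwards [h1, h2] with h hh1 hh2
  refine Set.mem_add.2 ⟨0, ⟨0, ⟨by linarith, hr⟩, by simp⟩, h, ⟨?_, ?_⟩, zero_add h⟩
  · simpa using hh1
  · simpa using hh2

theorem neg_mem_radialSlab {u : E} {f : StrongDual ℝ E} {r ρ η : ℝ} {l : E}
    (hl : l ∈ radialSlab u f r ρ η) : -l ∈ radialSlab u f r ρ η := by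
  obtain ⟨_, ⟨s, ⟨hs1, hs2⟩, rfl⟩, h, ⟨h1, h2⟩, rfl⟩ := Set.mem_add.1 hl
  refine Set.mem_add.2 ⟨_, ⟨-s, ⟨by linarith, by linarith⟩, rfl⟩, -h, ⟨by rwa [norm_neg], ?_⟩, ?_⟩
  · rwa [map_neg, abs_neg]
  · simp only [neg_smul]; abel

/-- A norming functional of a unit vector describes the norm near it up to the smoothness error. -/
theorem HasPowerSmoothness.norm_add_le {C q : ℝ} (hE : HasPowerSmoothness E C q) {u h : E}
    (hu : ‖u‖ = 1) (hh : ‖h‖ ≤ 1) {f : StrongDual ℝ E} (hf : ‖f‖ = 1) (hfu : f u = 1) :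
    ‖u + h‖ ≤ 1 + f h + 2 * (C * ‖h‖ ^ q) := by
  have h1 := hE u h hu hh
  have h2 : f (u - h) ≤ ‖u - h‖ := by
    have := (le_abs_self _).trans (f.le_opNorm (u - h))
    rwa [hf, one_mul] at this
  rw [map_sub, hfu] at h2
  linarith

/-- The chord between two nearby unit vectors is almost tangential. -/
theorem HasPowerSmoothness.abs_apply_sub_le {C q : ℝ} (hE : HasPowerSmoothness E C q)
    {u w : E} (hu : ‖u‖ = 1) (hw : ‖w‖ = 1) (hwu : ‖w - u‖ ≤ 1) {f : StrongDual ℝ E}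
    (hf : ‖f‖ = 1) (hfu : f u = 1) : |f (w - u)| ≤ 2 * (C * ‖w - u‖ ^ q) := by
  have h1 := hE.norm_add_le hu hwu hf hfu
  rw [add_sub_cancel, hw] at h1
  have h2 : f w ≤ 1 := by
    have := (le_abs_self _).trans (f.le_opNorm w)
    rwa [hf, one_mul, hw] at this
  have h3 : f (w - u) ≤ 0 := by rw [map_sub, hfu]; linarith
  rw [abs_of_nonpos h3]
  linarith

/-- The norm stays controlled when an almost tangential vector `g` is added to any point of the
segment through `u` and `-u`, slightly prolonged. -/
theorem HasPowerSmoothness.norm_smul_add_le {C q : ℝ} (hE : HasPowerSmoothness E C q)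
    {u g : E} (hu : ‖u‖ = 1) (hg : ‖g‖ ≤ 1) {f : StrongDual ℝ E} (hf : ‖f‖ = 1) (hfu : f u = 1)
    {a b η : ℝ} (hη : 0 ≤ η) (hgq : 2 * (C * ‖g‖ ^ q) ≤ a) (hfg : |f g| ≤ b) {τ : ℝ}
    (hτ : |τ| ≤ 1 + η) : ‖τ • u + g‖ ≤ 1 + a + b + η := by
  have hplus := hE.norm_add_le hu hg hf hfu
  have hminus := hE.norm_add_le hu (h := -g) (by rwa [norm_neg]) hf hfu
  rw [map_neg, norm_neg, ← sub_eq_add_neg, norm_sub_rev] at hminus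
  have hfg' := abs_le.1 hfg
  -- for `|σ| ≤ 1` the point `σ u + g` lies on the segment between `u + g` and `-u + g`
  have hseg : ∀ σ : ℝ, |σ| ≤ 1 → ‖σ • u + g‖ ≤ 1 + a + b := by
    intro σ hσ
    obtain ⟨hσ1, hσ2⟩ := abs_le.1 hσ
    have e : σ • u + g = ((1 + σ) / 2) • (u + g) + ((1 - σ) / 2) • (g - u) := by
      module
    rw [e]
    refine (_root_.norm_add_le _ _).trans ?_
    rw [norm_smul, norm_smul, Real.norm_of_nonneg (by linarith), Real.norm_of_nonneg (by linarith)]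
    nlinarith
  have hmove : ∀ σ : ℝ, |σ| ≤ 1 → |τ - σ| ≤ η → ‖τ • u + g‖ ≤ 1 + a + b + η := by
    intro σ hσ hτσ
    have e : τ • u + g = (σ • u + g) + (τ - σ) • u := by module
    rw [e]
    refine (_root_.norm_add_le _ _).trans (add_le_add (hseg σ hσ) ?_)
    rwa [norm_smul, hu, mul_one, Real.norm_eq_abs]
  obtain ⟨h1, h2⟩ := abs_le.1 hτ
  rcases le_total τ 1 with h | h
  · rcases le_total (-1) τ with h' | h'
    · exact hmove τ (abs_le.2 ⟨h', h⟩) (by simpa using hη)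
    · exact hmove (-1) (by norm_num) (abs_le.2 ⟨by linarith, by linarith⟩)
  · exact hmove 1 (by norm_num) (abs_le.2 ⟨by linarith, by linarith⟩)

/-- The intervals of half-length `2⁻ᵏ / 2 + η` around `1 - 2⁻ᵏ`, with `k ≤ m`, cover `[0, 1]` as
soon as `2⁻ᵐ ≤ η`. -/
theorem exists_dyadic_interval {η : ℝ} {m : ℕ} (hm : (1 / 2 : ℝ) ^ m ≤ η) {t : ℝ}
    (ht0 : 0 ≤ t) (ht1 : t ≤ 1) :
    ∃ k : Fin (m + 1), |t - (1 - (1 / 2 : ℝ) ^ (k : ℕ))| ≤ (1 / 2 : ℝ) ^ (k : ℕ) / 2 + η := by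
  have hmpos : (0 : ℝ) < (1 / 2) ^ m := by positivity
  rcases le_total (1 - t) ((1 / 2 : ℝ) ^ m) with h | h
  · exact ⟨Fin.last m, by rw [Fin.val_last]; exact abs_le.2 ⟨by linarith, by linarith⟩⟩
  · obtain ⟨k, hk1, hk2⟩ := exists_nat_pow_near_of_lt_one (x := 1 - t) (y := 1 / 2)
      (by linarith) (by linarith) (by norm_num) (by norm_num)
    rw [pow_succ] at hk1
    have hkm : k < m + 1 := by
      by_contra! hmk
      have : (1 / 2 : ℝ) ^ k ≤ (1 / 2) ^ (m + 1) :=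
        pow_le_pow_of_le_one (by norm_num) (by norm_num) hmk
      rw [pow_succ] at this
      linarith
    refine ⟨⟨k, hkm⟩, abs_le.2 ⟨?_, ?_⟩⟩ <;> simp only <;> linarith

/-- Number of dyadic scales between `1` and `ε / 8`, in terms of `log (1 / ε)`. -/
theorem exists_dyadic_scale {ε : ℝ} (hε : 0 < ε) (hε2 : ε ≤ 1 / 2) :
    ∃ m : ℕ, (1 / 2 : ℝ) ^ m ≤ ε / 8 ∧ ((m + 1 : ℕ) : ℝ) ≤ 12 * Real.log (1 / ε) := by
  have hlog2 := Real.log_two_gt_d9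
  have hlog : Real.log 2 ≤ Real.log (1 / ε) :=
    Real.log_le_log (by norm_num) (by rw [le_div_iff₀ hε]; linarith)
  refine ⟨⌈Real.log (8 / ε) / Real.log 2⌉₊, ?_, ?_⟩
  · rw [← Real.log_le_log_iff (by positivity) (by positivity), Real.log_pow, one_div,
      Real.log_inv, ← inv_div 8 ε, Real.log_inv]
    have := (div_le_iff₀ (by linarith)).1 (Nat.le_ceil (Real.log (8 / ε) / Real.log 2))
    linarith
  · have e : Real.log (8 / ε) = 3 * Real.log 2 + Real.log (1 / ε) := by
      rw [show (8 : ℝ) / ε = 2 ^ 3 * (1 / ε) by ring, Real.log_mul (by norm_num) (by positivity),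
        Real.log_pow]
      norm_num
    have h0 : 0 ≤ Real.log (8 / ε) / Real.log 2 := div_nonneg (by linarith) (by linarith)
    have h1 := (Nat.ceil_lt_add_one h0).le
    have h2 : Real.log (8 / ε) / Real.log 2 ≤ 3 + 2 * Real.log (1 / ε) := by
      rw [e, div_le_iff₀ (by linarith)]
      nlinarith
    push_cast
    linarith

/-- The unit ball of an `n`-dimensional norm with smoothness of power type `q` has a
`(2, ε)`-covering by about `log (1 / ε) * (1 / ε) ^ (n / q)` bodies: one for each point of a net of
the sphere at scale `ε ^ (1 / q)` and each dyadic distance to the boundary down to `ε`. -/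
theorem HasPowerSmoothness.exists_isTwoCovering {C q : ℝ} (hE : HasPowerSmoothness E C q)
    (hC : 1 ≤ C) (hq1 : 1 ≤ q) (hq2 : q ≤ 2) (hn : 1 ≤ n) (e : E ≃L[ℝ] (Fin n → ℝ))
    {ε : ℝ} (hε : 0 < ε) (hε2 : ε ≤ 1 / 2) :
    ∃ (N : ℕ) (Q : Fin N → Set (Fin n → ℝ)), IsTwoCovering ε (e '' Metric.closedBall 0 1) Q ∧
      (N : ℝ) ≤ (576 * C) ^ n * Real.log (1 / ε) * (1 / ε) ^ ((n : ℝ) / q) := by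
  have : FiniteDimensional ℝ E := e.symm.toLinearEquiv.finiteDimensional
  have hdim : Module.finrank ℝ E = n := by rw [e.toLinearEquiv.finrank_eq, Module.finrank_fin_fun]
  have hC0 : 0 < C := by linarith
  have hq0 : 0 < q := by linarith
  -- the smoothness error at distance `ρ` is `ε / 16`, a fixed fraction of the admissible one
  set ρ : ℝ := (ε / (16 * C)) ^ (1 / q) with hρdef
  have hρ : 0 < ρ := by positivity
  have hρq : C * ρ ^ q = ε / 16 := by
    rw [hρdef, ← Real.rpow_mul (by positivity), one_div_mul_cancel hq0.ne', Real.rpow_one]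
    field_simp
  have hρ2 : 2 * ρ ≤ 1 := by
    by_contra! hc
    have h1 : (1 / 2 : ℝ) ^ q ≤ ρ ^ q := Real.rpow_le_rpow (by norm_num) (by linarith) hq0.le
    have h2 : (1 / 2 : ℝ) ^ (2 : ℝ) ≤ (1 / 2) ^ q :=
      Real.rpow_le_rpow_of_exponent_ge (by norm_num) (by norm_num) hq2
    norm_num at h2
    nlinarith
  obtain ⟨net, hnet, hcard, hcover⟩ := exists_net_unit_sphere (E := E) hρ (by linarith)
  obtain ⟨m, hm, hmcard⟩ := exists_dyadic_scale hε hε2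
  have hf : ∀ u : net, ∃ f : StrongDual ℝ E, ‖f‖ = 1 ∧ f u = 1 := by
    intro u
    have hu := hnet u u.2
    simpa [hu] using exists_dual_vector ℝ (u : E) (by rw [hu]; exact one_ne_zero)
  choose f hf hfu using hf
  have hcovering : ∃ Q : Fin (Fintype.card (net × Fin (m + 1))) → Set (Fin n → ℝ),
      IsTwoCovering ε (e '' Metric.closedBall 0 1) Q := by
    refine exists_isTwoCovering_of_symmetric (ι := net × Fin (m + 1)) e hε
      (fun i => (1 - (1 / 2 : ℝ) ^ (i.2 : ℕ)) • (i.1 : E))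
      (fun i => radialSlab i.1 (f i.1) ((1 / 2 : ℝ) ^ (i.2 : ℕ) / 2 + ε / 8) ρ (ε / 8))
      (fun i => convex_radialSlab _ _ _ _ _) (fun i => isCompact_radialSlab _ _ _ _ _)
      (fun i => radialSlab_mem_nhds _ _ (by positivity) hρ (by positivity))
      (fun i l hl => neg_mem_radialSlab hl) ?_ ?_
    · intro y hy
      obtain ⟨w, hw, hyw⟩ : ∃ w : E, ‖w‖ = 1 ∧ y = ‖y‖ • w := by
        rcases eq_or_ne y 0 with rfl | hy0
        · have : Nontrivial E := Module.nontrivial_of_finrank_pos (R := ℝ) (by omega)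
          obtain ⟨w, hw⟩ := NormedSpace.sphere_nonempty (x := (0 : E)) (r := 1) |>.2 zero_le_one
          exact ⟨w, by simpa using hw, by simp⟩
        · have hy0' : ‖y‖ ≠ 0 := norm_ne_zero_iff.2 hy0
          exact ⟨‖y‖⁻¹ • y, by rw [norm_smul, norm_inv, norm_norm, inv_mul_cancel₀ hy0'],
            by rw [smul_inv_smul₀ hy0']⟩
      -- `y = ‖y‖ u + ‖y‖ (w - u)`: a radial term on the ray of `u` and an almost tangential one
      obtain ⟨u, hu, hwu⟩ := hcover w hw
      obtain ⟨k, hk⟩ := exists_dyadic_interval hm (norm_nonneg y) hy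
      have hgf := hE.abs_apply_sub_le (hnet u hu) hw (by linarith) (hf ⟨u, hu⟩) (hfu ⟨u, hu⟩)
      have hgq : C * ‖w - u‖ ^ q ≤ C * ρ ^ q := by gcongr
      refine ⟨(⟨u, hu⟩, k), _, Set.mem_add.2 ⟨_, ⟨_, abs_le.1 hk, rfl⟩, ‖y‖ • (w - u),
        ⟨?_, ?_⟩, rfl⟩, ?_⟩
      · rw [norm_smul, norm_norm]
        exact (mul_le_of_le_one_left (norm_nonneg _) hy).trans hwu
      · rw [map_smul, smul_eq_mul, abs_mul, abs_norm]
        exact (mul_le_of_le_one_left (abs_nonneg _) hy).trans (by linarith)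
      · conv_lhs => rw [hyw]
        simp only
        module
    · rintro ⟨u, k⟩ l hl
      obtain ⟨_, ⟨s, ⟨hs1, hs2⟩, rfl⟩, h, ⟨h1, h2⟩, rfl⟩ := Set.mem_add.1 hl
      have hk0 : (0 : ℝ) < (1 / 2) ^ (k : ℕ) := by positivity
      have hk1 : (1 / 2 : ℝ) ^ (k : ℕ) ≤ 1 := pow_le_one₀ (by norm_num) (by norm_num)
      have hg : ‖(2 : ℝ) • h‖ ≤ 2 * ρ := by
        rw [norm_smul, Real.norm_of_nonneg zero_le_two]; linarith
      have hgq : 2 * (C * ‖(2 : ℝ) • h‖ ^ q) ≤ ε / 2 := by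
        have h3 : ‖(2 : ℝ) • h‖ ^ q ≤ 4 * ρ ^ q :=
          calc ‖(2 : ℝ) • h‖ ^ q ≤ (2 * ρ) ^ q := by gcongr
            _ = 2 ^ q * ρ ^ q := Real.mul_rpow (by norm_num) hρ.le
            _ ≤ 2 ^ (2 : ℝ) * ρ ^ q := by gcongr; norm_num
            _ = 4 * ρ ^ q := by norm_num
        have h4 := mul_le_mul_of_nonneg_left h3 hC0.le
        linarith
      have hfg : |f u ((2 : ℝ) • h)| ≤ ε / 4 := by
        rw [map_smul, smul_eq_mul, abs_mul, abs_of_pos (zero_lt_two' ℝ)]; linarith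
      have := hE.norm_smul_add_le (hnet u u.2) (hg.trans hρ2) (hf u) (hfu u) (η := ε / 4)
        (by positivity) hgq hfg (τ := 1 - (1 / 2) ^ (k : ℕ) + 2 * s)
        (abs_le.2 ⟨by simp only at hs1; linarith, by simp only at hs2; linarith⟩)
      have e2 : (1 - (1 / 2 : ℝ) ^ (k : ℕ)) • (u : E) + (2 : ℝ) • (s • (u : E) + h) =
          (1 - (1 / 2 : ℝ) ^ (k : ℕ) + 2 * s) • (u : E) + (2 : ℝ) • h := by module
      simp only
      rw [e2]
      linarith
  obtain ⟨Q, hQ⟩ := hcovering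
  refine ⟨_, Q, hQ, ?_⟩
  rw [Fintype.card_prod, Fintype.card_coe, Fintype.card_fin, Nat.cast_mul]
  have hρn : (3 / ρ) ^ n ≤ (48 * C) ^ n * (1 / ε) ^ ((n : ℝ) / q) := by
    have h1 : (1 / ρ) ^ n = (16 * C) ^ ((n : ℝ) / q) * (1 / ε) ^ ((n : ℝ) / q) := by
      rw [hρdef, one_div, ← Real.inv_rpow (by positivity), inv_div, ← Real.rpow_natCast,
        ← Real.rpow_mul (by positivity), ← Real.mul_rpow (by positivity) (by positivity)]
      congr 1 <;> ring
    have h2 : (16 * C) ^ ((n : ℝ) / q) ≤ (16 * C) ^ n := by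
      rw [← Real.rpow_natCast (16 * C) n]
      exact Real.rpow_le_rpow_of_exponent_le (by linarith) (div_le_self (by positivity) hq1)
    calc (3 / ρ) ^ n = 3 ^ n * (1 / ρ) ^ n := by rw [← mul_pow]; ring
      _ = 3 ^ n * ((16 * C) ^ ((n : ℝ) / q) * (1 / ε) ^ ((n : ℝ) / q)) := by rw [h1]
      _ ≤ 3 ^ n * ((16 * C) ^ n * (1 / ε) ^ ((n : ℝ) / q)) := by gcongr
      _ = _ := by rw [← mul_assoc, ← mul_pow]; ring
  have h12 : (12 : ℝ) ≤ 12 ^ n := le_self_pow₀ (by norm_num) (by omega)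
  have hlog : 0 ≤ Real.log (1 / ε) :=
    Real.log_nonneg (by rw [le_div_iff₀ hε]; linarith)
  rw [hdim] at hcard
  calc (net.card : ℝ) * ((m + 1 : ℕ) : ℝ)
      ≤ ((48 * C) ^ n * (1 / ε) ^ ((n : ℝ) / q)) * (12 ^ n * Real.log (1 / ε)) := by
        gcongr
        · exact hcard.trans hρn
        · exact hmcard.trans (by gcongr)
    _ = _ := by
        rw [show 576 * C = 48 * C * 12 by ring, mul_pow (48 * C)]
        ring

end SmoothNorm

/-! ### The balls `B_p^n` -/

theorem image_closedBall_piLp {n : ℕ} {p : ℝ} (hp : 1 ≤ p) [Fact (1 ≤ ENNReal.ofReal p)] :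
    PiLp.continuousLinearEquiv (ENNReal.ofReal p) ℝ (fun _ : Fin n => ℝ) '' Metric.closedBall 0 1 =
      lpUnitBall n p := by
  have hp' : (ENNReal.ofReal p).toReal = p := ENNReal.toReal_ofReal (by linarith)
  have hnorm (x : PiLp (ENNReal.ofReal p) (fun _ : Fin n => ℝ)) :
      ‖x‖ = (∑ i, |x i| ^ p) ^ (1 / p) := by
    rw [PiLp.norm_eq_sum (by rw [hp']; linarith), hp']
    rfl
  ext y
  constructor
  · rintro ⟨x, hx, rfl⟩
    rw [mem_closedBall_zero_iff, hnorm] at hx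
    exact hx
  · intro hy
    refine ⟨WithLp.toLp _ y, ?_, rfl⟩
    rw [mem_closedBall_zero_iff, hnorm]
    exact hy

theorem pow_eq_two_rpow_logb_mul {A : ℝ} (hA : 0 < A) (n : ℕ) :
    A ^ n = (2 : ℝ) ^ (Real.logb 2 A * (n : ℝ)) := by
  rw [Real.rpow_mul (by norm_num), Real.rpow_logb (by norm_num) (by norm_num) hA,
    Real.rpow_natCast]

theorem mainTheorem8 :
    ∃ ε₀ : ℝ, 0 < ε₀ ∧
      (∀ p : ℝ, 2 ≤ p → ∃ c : ℝ, ∀ n : ℕ, 1 ≤ n → ∀ ε : ℝ, 0 < ε → ε ≤ ε₀ →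
        ∃ (N : ℕ) (Q : Fin N → Set (Fin n → ℝ)),
          IsTwoCovering ε (lpUnitBall n p) Q ∧
            (N : ℝ) ≤ (2 : ℝ) ^ (c * (n : ℝ)) * Real.log (1 / ε) * (1 / ε) ^ ((n : ℝ) / 2)) ∧
      (∃ c : ℝ, ∀ p : ℝ, 1 ≤ p → p ≤ 2 → ∀ n : ℕ, 1 ≤ n → ∀ ε : ℝ, 0 < ε → ε ≤ ε₀ →
        ∃ (N : ℕ) (Q : Fin N → Set (Fin n → ℝ)),
          IsTwoCovering ε (lpUnitBall n p) Q ∧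
            (N : ℝ) ≤ (2 : ℝ) ^ (c * (n : ℝ)) * Real.log (1 / ε) * (1 / ε) ^ ((n : ℝ) / p)) := by

  refine ⟨1 / 2, by norm_num, fun p hp => ?_, Real.logb 2 576, fun p hp hp2 n hn ε hε hε2 => ?_⟩
  · have hfact : Fact (1 ≤ ENNReal.ofReal p) := ⟨by
      rw [ENNReal.one_le_ofReal]; linarith⟩
    have hC : 1 ≤ (2 * p ^ 2 + 8) * 2 ^ p :=
      one_le_mul_of_one_le_of_one_le (by nlinarith)
        (Real.one_le_rpow (by norm_num) (by linarith))
    refine ⟨Real.logb 2 (576 * ((2 * p ^ 2 + 8) * 2 ^ p)), fun n hn ε hε hε2 => ?_⟩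
    rw [← image_closedBall_piLp (by linarith : 1 ≤ p), ← pow_eq_two_rpow_logb_mul (by positivity)]
    exact (hasPowerSmoothness_piLp_of_two_le hp).exists_isTwoCovering hC (by norm_num) le_rfl hn
      _ hε hε2
  · have hfact : Fact (1 ≤ ENNReal.ofReal p) := ⟨by
      rw [ENNReal.one_le_ofReal]; exact hp⟩
    rw [← image_closedBall_piLp hp, ← pow_eq_two_rpow_logb_mul (by norm_num)]
    have := (hasPowerSmoothness_piLp_of_le_two (n := n) hp hp2).exists_isTwoCovering le_rfl hp hp2 hn
      (PiLp.continuousLinearEquiv (ENNReal.ofReal p) ℝ fun _ : Fin n => ℝ) hε hε2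
    rwa [mul_one] at this
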